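/- Let $E,A\in\mathbb R^{n_x\times n_x}$, $B\in\mathbb R^{n_x\times n_u}$, $C\in\mathbb R^{n_y\times n_x}$, $D\in\mathbb R^{n_y\times n_u}$, where the pencil $\lambda E-A$ is regular, i.e. $\det(\lambda E-A)\neq 0$ for some $\lambda\in\mathbb C$, and consider the discrete-time descriptor system $$E x_{k+1}=Ax_k+Bu_k,\qquad y_k=Cx_k+Du_k,\qquad k\in\mathbb N=\{0,1,2,\dots\}.$$ Its infinite-horizon behavior $\mathfrak B_\infty$ is the set of all real sequences $b=(x_k,u_k,y_k)_{k\in\mathbb N}$ that satisfy these equations for all $k$. The behavior is called controllable if for all $b,\tilde b\in\mathfrak B_\infty$ and all $T\in\mathbb N$ there are a transition delay $T'\in\mathbb N$ and $b'\in\mathfrak B_\infty$ with $$b'_k=b_k\ \text{ for } 0\le k\le T-1,\qquad b'_k=\tilde b_{k-T-T'}\ \text{ for } k\ge T+T'. \tag{$*$}$$ The system is called R-controllable if $\operatorname{rk}[\lambda E-A,\ B]=n_x$ for all $\lambda\in\mathbb C$. By regularity there is a quasi-Weierstraß form: there are invertible $S,P\in\mathbb R^{n_x\times n_x}$ with $$S(\lambda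 E-A)P=\lambda\begin{bmatrix} I_{n_J}&0\\0&N\end{bmatrix}-\begin{bmatrix} J&0\\0&I_{n_N}\end{bmatrix},\qquad n_J+n_N=n_x,$$ where $J\in\mathbb R^{n_J\times n_J}$ and where $N\in\mathbb R^{n_N\times n_N}$ is nilpotent. Given such a form, let $B_N$ be the matrix of the last $n_N$ rows of $SB$. The structured nilpotency index is $\delta=\min\{i\in\mathbb N: N^iB_N=0\}$ if $n_N>0$ and $B_N\neq0$, and $\delta=1$ otherwise. Then $\mathfrak B_\infty$ is controllable if and only if the system is R-controllable. In this case, for every quasi-Weierstraß form, the transition delay can be chosen as $T'=\delta-1+n_J$, uniformly over all trajectories: with this $T'$, for all $b,\tilde b\in\mathfrak B_\infty$ and all $T\in\mathbb N$ there is $b'\in\mathfrak B_\infty$ satisfying $(*)$. -/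

import Mathlib

/-- The data of a real discrete-time linear descriptor system
`E x_{k+1} = A x_k + B u_k`, `y_k = C x_k + D u_k`. -/
structure DescriptorSystem (nx nu ny : ℕ) where
  E : Matrix (Fin nx) (Fin nx) ℝ
  A : Matrix (Fin nx) (Fin nx) ℝ
  B : Matrix (Fin nx) (Fin nu) ℝ
  C : Matrix (Fin ny) (Fin nx) ℝ
  D : Matrix (Fin ny) (Fin nu) ℝ

/-- A trajectory `(x, u, y)` with time axis `ℕ` attains values in `ℝ^nx × ℝ^nu × ℝ^ny`. -/
abbrev SignalSpace (nx nu ny : ℕ) : Type :=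
  (Fin nx → ℝ) × (Fin nu → ℝ) × (Fin ny → ℝ)

/-- `b` on `[0, T - 1]` can be continued, after a transition phase of length `T'`, by the
whole trajectory `b₂` (which then starts at time `T + T'`), within the behavior `𝔅`. -/
def CanSwitch {W : Type*} (𝔅 : Set (ℕ → W)) (b b₂ : ℕ → W) (T T' : ℕ) : Prop :=
  ∃ b' ∈ 𝔅, (∀ k < T, b' k = b k) ∧ (∀ k, T + T' ≤ k → b' k = b₂ (k - (T + T')))

/-- Controllability of a behavior: any past of any trajectory can be concatenated with any other
trajectory after some transition delay `T'`, which may depend on the trajectories and on `T`. -/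
def IsControllableBehavior {W : Type*} (𝔅 : Set (ℕ → W)) : Prop :=
  ∀ b ∈ 𝔅, ∀ b₂ ∈ 𝔅, ∀ T : ℕ, ∃ T' : ℕ, CanSwitch 𝔅 b b₂ T T'

/-- The transition delay can be chosen as `T'` for all trajectories and all `T`. -/
def HasUniformTransitionDelay {W : Type*} (𝔅 : Set (ℕ → W)) (T' : ℕ) : Prop :=
  ∀ b ∈ 𝔅, ∀ b₂ ∈ 𝔅, ∀ T : ℕ, CanSwitch 𝔅 b b₂ T T'

namespace DescriptorSystem

variable {nx nu ny : ℕ}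

/-- The infinite-horizon (full) behavior: all `(x, u, y)` that satisfy the system equations. -/
def behavior (sys : DescriptorSystem nx nu ny) : Set (ℕ → SignalSpace nx nu ny) :=
  {b | ∀ k : ℕ,
      sys.E.mulVec (b (k + 1)).1 = sys.A.mulVec (b k).1 + sys.B.mulVec (b k).2.1 ∧
      (b k).2.2 = sys.C.mulVec (b k).1 + sys.D.mulVec (b k).2.1}

/-- The complex matrix `z E - A`. -/
noncomputable def pencil (sys : DescriptorSystem nx nu ny) (z : ℂ) :
    Matrix (Fin nx) (Fin nx) ℂ :=
  z • sys.E.map Complex.ofReal - sys.A.map Complex.ofReal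

/-- Regularity of the pencil: `det (z E - A) ≠ 0` for some complex `z`. -/
def IsRegular (sys : DescriptorSystem nx nu ny) : Prop :=
  ∃ z : ℂ, (sys.pencil z).det ≠ 0

/-- R-controllability: `[z E - A, B]` has rank `nx` for all complex `z`. -/
def IsRControllable (sys : DescriptorSystem nx nu ny) : Prop :=
  ∀ z : ℂ, (Matrix.fromCols (sys.pencil z) (sys.B.map Complex.ofReal)).rank = nx

/-- A quasi-Weierstrass form: invertible real `S`, `P` and a splitting `nJ + nN = nx` with
`S (z E - A) P = z diag(I, N) - diag(J, I)` (compared coefficientwise in `z`), `N` nilpotent. -/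
structure QuasiWeierstrassForm (sys : DescriptorSystem nx nu ny) where
  nJ : ℕ
  nN : ℕ
  dim_eq : nJ + nN = nx
  S : Matrix (Fin nx) (Fin nx) ℝ
  P : Matrix (Fin nx) (Fin nx) ℝ
  J : Matrix (Fin nJ) (Fin nJ) ℝ
  N : Matrix (Fin nN) (Fin nN) ℝ
  isUnit_S : IsUnit S
  isUnit_P : IsUnit P
  isNilpotent_N : IsNilpotent N
  transform_E : S * sys.E * P =
    Matrix.reindex (finSumFinEquiv.trans (finCongr dim_eq)) (finSumFinEquiv.trans (finCongr dim_eq))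
      (Matrix.fromBlocks 1 0 0 N)
  transform_A : S * sys.A * P =
    Matrix.reindex (finSumFinEquiv.trans (finCongr dim_eq)) (finSumFinEquiv.trans (finCongr dim_eq))
      (Matrix.fromBlocks J 0 0 1)

namespace QuasiWeierstrassForm

variable {sys : DescriptorSystem nx nu ny}

/-- `B_N`, the last `nN` rows of `S B`. -/
def BN (Q : sys.QuasiWeierstrassForm) : Matrix (Fin Q.nN) (Fin nu) ℝ :=
  Matrix.of fun i j => (Q.S * sys.B) (finCongr Q.dim_eq (finSumFinEquiv (Sum.inr i))) j

open Classical in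
/-- The structured nilpotency index: `min {i | N ^ i B_N = 0}` if `nN > 0` and `B_N ≠ 0`,
and `1` otherwise. -/
noncomputable def structuredIndex (Q : sys.QuasiWeierstrassForm) : ℕ :=
  if 0 < Q.nN ∧ Q.BN ≠ 0 then sInf {i : ℕ | Q.N ^ i * Q.BN = 0} else 1

/-- The minimum in the definition of the structured nilpotency index is attained. -/
theorem structuredIndex_spec (Q : sys.QuasiWeierstrassForm) :
    Q.N ^ Q.structuredIndex * Q.BN = 0 := by
  unfold structuredIndex
  split_ifs with h
  · obtain ⟨m, hm⟩ := Q.isNilpotent_N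
    exact Nat.sInf_mem (s := {i : ℕ | Q.N ^ i * Q.BN = 0}) ⟨m, by simp [hm]⟩
  · have hB : Q.BN = 0 := by
      by_contra hne
      apply h
      refine ⟨Nat.pos_of_ne_zero fun h0 => hne ?_, hne⟩
      ext i
      exact absurd i.2 (by omega)
    simp [hB]

/-- The structured nilpotency index is at least one, so `structuredIndex - 1` is not truncated. -/
theorem one_le_structuredIndex (Q : sys.QuasiWeierstrassForm) : 1 ≤ Q.structuredIndex := by
  by_contra hlt
  have h0 : Q.structuredIndex = 0 := by omega
  have hs := Q.structuredIndex_spec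
  rw [h0, pow_zero, Matrix.one_mul] at hs
  simp [structuredIndex, hs] at h0

end QuasiWeierstrassForm

end DescriptorSystem

/-! In quasi-Weierstraß coordinates the system splits into a slow part `z⁺ = J z + B_J u` and a fast
part `N w⁺ = w + B_N u`. Nilpotency forces `w k = -∑_{i<δ} N^i B_N u (k+i)`, so a trajectory amounts
to a slow trajectory with a free input, and its state looks `δ - 1` steps ahead (`fast_eq_neg_sum`,
`fast_equation_neg_sum`).

Sufficiency: R-controllability gives the Hautus test for `(J, B_J)`, hence Kalman's rank condition
and steering in `nJ` steps (`exists_steering`). The old input is kept for `δ - 1` extra steps, which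
protects the past states; then the slow state is steered.

Necessity: if `v` annihilates `[μE - A, B]`, then `ξ = v E x` satisfies `ξ⁺ = μ ξ` whatever the
input. Started at zero it stays zero, so controllability makes it vanish at every reachable start,
which forces `v = 0`.

A form exists by Fitting's lemma applied to `(μE - A)⁻¹ E` at a real `μ`. -/

open Matrix

/-! ### Hautus and Kalman criteria, steering of explicit systems. -/

/-- A complex matrix has full row rank iff its left kernel is trivial. -/
theorem rank_eq_iff_vecMul_eq_zero {m : ℕ} {ι K : Type*} [Fintype ι] [Field K]
    (M : Matrix (Fin m) ι K) : M.rank = m ↔ ∀ v : Fin m → K, v ᵥ* M = 0 → v = 0 := by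
  have h1 : M.rank = m ↔ LinearIndependent K M.row := by
    rw [linearIndependent_iff_card_eq_finrank_span, Fintype.card_fin, rank_eq_finrank_span_row,
      Set.finrank, eq_comm]
  rw [h1, ← Matrix.vecMul_injective_iff]
  constructor
  · intro h v hv
    exact h (by simpa using hv)
  · intro h v w hvw
    have := h (v - w) (by rw [Matrix.sub_vecMul]; exact sub_eq_zero.2 hvw)
    exact sub_eq_zero.1 this

/-- A vector annihilating the first `n` Kalman blocks annihilates all of them. -/
theorem vecMul_pow_mul_eq_zero_of_lt {n m : ℕ} (J : Matrix (Fin n) (Fin n) ℝ)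
    (B : Matrix (Fin n) (Fin m) ℝ) (v : Fin n → ℝ)
    (h : ∀ i < n, v ᵥ* (J ^ i * B) = 0) (k : ℕ) : v ᵥ* (J ^ k * B) = 0 := by
  rcases Nat.eq_zero_or_pos n with rfl | hn
  · have : v = 0 := Subsingleton.elim _ _
    simp [this]
  have hdeg : (Polynomial.X ^ k %ₘ J.charpoly).natDegree < n := by
    have h1 : J.charpoly ≠ 1 := by
      intro h1
      have := J.charpoly_natDegree_eq_dim
      rw [h1] at this
      simp at this
      omega
    have := Polynomial.natDegree_modByMonic_lt (Polynomial.X ^ k) J.charpoly_monic h1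
    simpa using this
  -- Cayley–Hamilton: only the remainder of `X ^ k` modulo the characteristic polynomial matters,
  -- and its degree is below `n`.
  rw [Matrix.pow_eq_aeval_mod_charpoly, Polynomial.aeval_eq_sum_range' hdeg, Matrix.sum_mul,
    Matrix.vecMul_sum]
  refine Finset.sum_eq_zero fun i hi => ?_
  rw [Matrix.smul_mul, Matrix.vecMul_smul, h i (Finset.mem_range.1 hi), smul_zero]

/-- Hautus' eigenvector criterion implies Kalman's: a row vector that annihilates every
`J ^ i * B` vanishes. -/
theorem eq_zero_of_vecMul_pow_mul_eq_zero {n m : ℕ} (J : Matrix (Fin n) (Fin n) ℂ)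
    (B : Matrix (Fin n) (Fin m) ℂ)
    (h : ∀ (z : ℂ) (v : Fin n → ℂ), v ᵥ* J = z • v → v ᵥ* B = 0 → v = 0)
    (v : Fin n → ℂ) (hv : ∀ k, v ᵥ* (J ^ k * B) = 0) : v = 0 := by
  by_contra hne
  -- `W` is invariant under `w ↦ w J`; if nonzero it contains an eigenvector, which annihilates `B`
  -- and contradicts `h`.
  let W : Submodule ℂ (Fin n → ℂ) :=
    { carrier := {w | ∀ k, w ᵥ* (J ^ k * B) = 0}
      add_mem' := fun {a b} ha hb k => by rw [Matrix.add_vecMul, ha k, hb k, add_zero]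
      zero_mem' := fun k => by simp
      smul_mem' := fun c a ha k => by rw [Matrix.smul_vecMul, ha k, smul_zero] }
  have hinv : ∀ w ∈ W, J.vecMulLinear w ∈ W := by
    intro w hw k
    rw [Matrix.vecMulLinear_apply, Matrix.vecMul_vecMul, ← Matrix.mul_assoc, ← pow_succ']
    exact hw (k + 1)
  have : Nontrivial W := ⟨⟨⟨v, hv⟩, 0, fun h0 => hne (congrArg Subtype.val h0)⟩⟩
  obtain ⟨z, hz⟩ := Module.End.exists_eigenvalue (J.vecMulLinear.restrict hinv)
  obtain ⟨w, hw⟩ := hz.exists_hasEigenvector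
  apply hw.2
  apply Subtype.ext
  refine h z w.1 ?_ ?_
  · exact congrArg Subtype.val hw.apply_eq_smul
  · simpa using w.2 0

/-- Under the Hautus criterion every vector is a combination of the first `n` Kalman blocks. -/
theorem exists_sum_pow_mul_mulVec_eq {n m : ℕ} (J : Matrix (Fin n) (Fin n) ℝ)
    (B : Matrix (Fin n) (Fin m) ℝ)
    (h : ∀ (z : ℂ) (v : Fin n → ℂ), v ᵥ* J.map Complex.ofReal = z • v →
      v ᵥ* B.map Complex.ofReal = 0 → v = 0) (x : Fin n → ℝ) :
    ∃ c : ℕ → Fin m → ℝ, ∑ i ∈ Finset.range n, (J ^ i * B) *ᵥ c i = x := by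
  let K : Matrix (Fin n) (Fin n × Fin m) ℝ := Matrix.of fun r p => (J ^ (p.1 : ℕ) * B) r p.2
  have hK : K.rank = n := by
    rw [rank_eq_iff_vecMul_eq_zero]
    intro v hv
    have h1 : ∀ i < n, v ᵥ* (J ^ i * B) = 0 := by
      intro i hi
      ext c
      exact congrFun hv (⟨i, hi⟩, c)
    have h2 := vecMul_pow_mul_eq_zero_of_lt J B v h1
    -- The Hautus test needs complex eigenvectors, so the real vector is complexified.
    have h3 : (Complex.ofRealHom ∘ v : Fin n → ℂ) = 0 := by
      refine eq_zero_of_vecMul_pow_mul_eq_zero (J.map Complex.ofRealHom)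
        (B.map Complex.ofRealHom) h _ fun k => ?_
      ext c
      have := congrArg Complex.ofRealHom (congrFun (h2 k) c)
      rw [RingHom.map_vecMul] at this
      simpa [Matrix.map_mul, Matrix.map_pow] using this
    ext i
    simpa using congrFun h3 i
  have hsurj : Function.Surjective K.mulVecLin := by
    rw [← LinearMap.range_eq_top]
    apply Submodule.eq_top_of_finrank_eq
    rw [← Matrix.rank, hK, Module.finrank_fin_fun]
  obtain ⟨c, hc⟩ := hsurj x
  refine ⟨fun i j => if hi : i < n then c (⟨i, hi⟩, j) else 0, ?_⟩
  rw [Finset.sum_range, ← hc]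
  ext r
  simp [K, Matrix.mulVec, dotProduct, Fintype.sum_prod_type]

/-- Under the Hautus criterion any state can be steered to any other one in `n` steps. -/
theorem exists_steering {n m : ℕ} (J : Matrix (Fin n) (Fin n) ℝ) (B : Matrix (Fin n) (Fin m) ℝ)
    (h : ∀ (z : ℂ) (v : Fin n → ℂ), v ᵥ* J.map Complex.ofReal = z • v →
      v ᵥ* B.map Complex.ofReal = 0 → v = 0) (x₀ x₁ : Fin n → ℝ) :
    ∃ (x : ℕ → Fin n → ℝ) (u : ℕ → Fin m → ℝ), x 0 = x₀ ∧ x n = x₁ ∧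
      ∀ k, x (k + 1) = J *ᵥ x k + B *ᵥ u k := by
  obtain ⟨c, hc⟩ := exists_sum_pow_mul_mulVec_eq J B h (x₁ - J ^ n *ᵥ x₀)
  -- Time is reversed: the input at time `k` reaches time `n` with the factor `J ^ (n - 1 - k)`.
  -- Values from time `n` on are irrelevant.
  let u : ℕ → Fin m → ℝ := fun k => c (n - 1 - k)
  let x : ℕ → Fin n → ℝ := fun k =>
    J ^ k *ᵥ x₀ + ∑ i ∈ Finset.range k, (J ^ (k - 1 - i) * B) *ᵥ u i
  refine ⟨x, u, by simp [x], ?_, fun k => ?_⟩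
  · have : ∑ i ∈ Finset.range n, (J ^ (n - 1 - i) * B) *ᵥ u i = x₁ - J ^ n *ᵥ x₀ := by
      rw [← hc]
      exact Finset.sum_range_reflect (fun i => (J ^ i * B) *ᵥ c i) n
    simp only [x, this]
    abel
  · simp only [x]
    rw [Finset.sum_range_succ, Matrix.mulVec_add, Matrix.mulVec_mulVec, ← pow_succ',
      Matrix.mulVec_sum, add_assoc]
    congr 2
    · refine Finset.sum_congr rfl fun i hi => ?_
      rw [Matrix.mulVec_mulVec, ← Matrix.mul_assoc, ← pow_succ']
      have := Finset.mem_range.1 hi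
      congr 3
      omega
    · simp

/-! ### Fitting decomposition. -/

/-- Fitting's lemma for matrices: a square matrix is similar to a block diagonal matrix with an
invertible and a nilpotent block. -/
theorem exists_fitting_form {n : ℕ} (M : Matrix (Fin n) (Fin n) ℝ) :
    ∃ (p q : ℕ) (hpq : p + q = n) (P : Matrix (Fin n) (Fin n) ℝ)
      (M₁ : Matrix (Fin p) (Fin p) ℝ) (M₂ : Matrix (Fin q) (Fin q) ℝ),
      IsUnit P ∧ IsUnit M₁ ∧ IsNilpotent M₂ ∧
      P⁻¹ * M * P =
        Matrix.reindex (finSumFinEquiv.trans (finCongr hpq)) (finSumFinEquiv.trans (finCongr hpq))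
          (Matrix.fromBlocks M₁ 0 0 M₂) := by
  let f : Module.End ℝ (Fin n → ℝ) := Matrix.toLin' M
  obtain ⟨k, hk⟩ := Filter.eventually_atTop.1 (LinearMap.eventually_isCompl_ker_pow_range_pow f)
  -- A positive exponent ensures `ker f ≤ L`, whence `f` is injective on `R`.
  have hc := (hk (k + 1) (Nat.le_succ k)).symm
  set R := LinearMap.range (f ^ (k + 1)) with hR
  set L := LinearMap.ker (f ^ (k + 1)) with hL
  have hfR : ∀ x ∈ R, f x ∈ R := by
    rintro _ ⟨y, rfl⟩
    exact ⟨f y, by rw [← Module.End.mul_apply, ← Module.End.mul_apply, ← pow_succ, ← pow_succ']⟩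
  have hfL : ∀ x ∈ L, f x ∈ L := by
    intro x hx
    rw [hL, LinearMap.mem_ker] at hx ⊢
    rw [← Module.End.mul_apply, ← pow_succ, pow_succ', Module.End.mul_apply, hx, map_zero]
  let bR := Module.finBasis ℝ R
  let bL := Module.finBasis ℝ L
  have hpq : Module.finrank ℝ R + Module.finrank ℝ L = n := by
    rw [Submodule.finrank_add_eq_of_isCompl hc, Module.finrank_fin_fun]
  let e := finSumFinEquiv.trans (finCongr hpq)
  let b := ((bR.prod bL).map (Submodule.prodEquivOfIsCompl R L hc)).reindex e
  have hbR : ∀ i, b (e (Sum.inl i)) = bR i := by intro i; simp [b]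
  have hbL : ∀ i, b (e (Sum.inr i)) = bL i := by intro i; simp [b]
  let M₁ := LinearMap.toMatrix bR bR (f.restrict hfR)
  let M₂ := LinearMap.toMatrix bL bL (f.restrict hfL)
  let P := (Pi.basisFun ℝ (Fin n)).toMatrix b
  have hPinv : b.toMatrix (Pi.basisFun ℝ (Fin n)) * P = 1 := b.toMatrix_mul_toMatrix_flip _
  have hfb : LinearMap.toMatrix b b f = Matrix.reindex e e (Matrix.fromBlocks M₁ 0 0 M₂) := by
    apply (Matrix.toLin b b).injective
    rw [Matrix.toLin_toMatrix]
    apply b.ext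
    intro j
    obtain ⟨j, rfl⟩ := e.surjective j
    rw [Matrix.toLin_self, ← e.sum_comp, Fintype.sum_sum_type]
    rcases j with j | j
    · simp only [hbR, hbL, Matrix.reindex_apply, Matrix.submatrix_apply, Equiv.symm_apply_apply,
        Matrix.fromBlocks_apply₁₁, Matrix.fromBlocks_apply₂₁, Matrix.zero_apply, zero_smul,
        Finset.sum_const_zero, add_zero]
      have := congrArg Subtype.val (Matrix.toLin_self bR bR M₁ j)
      rw [Matrix.toLin_toMatrix] at this
      simpa using this
    · simp only [hbR, hbL, Matrix.reindex_apply, Matrix.submatrix_apply, Equiv.symm_apply_apply,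
        Matrix.fromBlocks_apply₁₂, Matrix.fromBlocks_apply₂₂, Matrix.zero_apply, zero_smul,
        Finset.sum_const_zero, zero_add]
      have := congrArg Subtype.val (Matrix.toLin_self bL bL M₂ j)
      rw [Matrix.toLin_toMatrix] at this
      simpa using this
  refine ⟨_, _, hpq, P, M₁, M₂, ?_, ?_, ?_, ?_⟩
  · exact isUnit_iff_exists_inv'.2 ⟨_, hPinv⟩
  · have hinj : Function.Injective (f.restrict hfR) := by
      rw [← LinearMap.ker_eq_bot, LinearMap.ker_eq_bot']
      rintro ⟨x, hx⟩ h0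
      have h0' : f x = 0 := congrArg Subtype.val h0
      have hxL : x ∈ L := by
        rw [hL, LinearMap.mem_ker, pow_succ, Module.End.mul_apply, h0', map_zero]
      exact Subtype.ext (Submodule.disjoint_def.1 hc.disjoint x hx hxL)
    have hu : IsUnit (f.restrict hfR) := LinearMap.isUnit_iff_ker_eq_bot _ |>.2
      (LinearMap.ker_eq_bot.2 hinj)
    exact hu.map (LinearMap.toMatrixAlgEquiv bR)
  · refine IsNilpotent.map (f := LinearMap.toMatrixAlgEquiv bL) ⟨k + 1, ?_⟩
    rw [Module.End.pow_restrict]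
    ext ⟨x, hx⟩ : 1
    exact Subtype.ext (LinearMap.mem_ker.1 hx)
  · rw [Matrix.inv_eq_left_inv hPinv]
    have h1 : LinearMap.toMatrix (Pi.basisFun ℝ (Fin n)) (Pi.basisFun ℝ (Fin n)) f = M :=
      LinearMap.toMatrix'_toLin' M
    have h2 := basis_toMatrix_mul_linearMap_toMatrix_mul_basis_toMatrix b
      (Pi.basisFun ℝ (Fin n)) b (Pi.basisFun ℝ (Fin n)) f
    rw [h1] at h2
    exact h2.trans hfb

/-! ### Existence of a quasi-Weierstraß form. -/

namespace DescriptorSystem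

variable {nx nu ny : ℕ}

/-- A regular real pencil is invertible at some real point. -/
theorem IsRegular.exists_real {sys : DescriptorSystem nx nu ny} (h : sys.IsRegular) :
    ∃ μ : ℝ, (μ • sys.E - sys.A).det ≠ 0 := by
  obtain ⟨z, hz⟩ := h
  by_contra! hall
  -- A real polynomial vanishing at every real point is zero, so it would vanish at `z` too.
  let q : Polynomial ℝ := ((Polynomial.X : Polynomial ℝ) • sys.E.map Polynomial.C - sys.A.map Polynomial.C).det
  have hq : q = 0 := by
    apply Polynomial.funext
    intro μ
    rw [Polynomial.eval_zero, ← hall μ, ← Polynomial.coe_evalRingHom, RingHom.map_det]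
    congr 1
    ext i j
    simp
    exact mul_comm _ _
  apply hz
  have : (sys.pencil z).det = Polynomial.eval₂RingHom Complex.ofRealHom z q := by
    rw [RingHom.map_det]
    congr 1
    ext i j
    simp [pencil]
    exact mul_comm _ _
  rw [this, hq, map_zero]

/-- A regular pencil has a quasi-Weierstrass form. -/
theorem IsRegular.nonempty_quasiWeierstrassForm {sys : DescriptorSystem nx nu ny}
    (h : sys.IsRegular) : Nonempty sys.QuasiWeierstrassForm := by
  obtain ⟨μ, hμ⟩ := h.exists_real
  set R := μ • sys.E - sys.A with hR
  have hRu : IsUnit R.det := isUnit_iff_ne_zero.2 hμ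
  obtain ⟨p, q, hpq, P, M₁, M₂, hP, hM₁, hM₂, hM⟩ := exists_fitting_form (R⁻¹ * sys.E)
  set e := finSumFinEquiv.trans (finCongr hpq)
  have hPu := (Matrix.isUnit_iff_isUnit_det P).1 hP
  -- Since `R⁻¹ A = μ R⁻¹ E - 1`, the basis splitting `R⁻¹ E` also splits `R⁻¹ A`.
  have hA : P⁻¹ * (R⁻¹ * sys.A) * P =
      Matrix.reindex e e (Matrix.fromBlocks (μ • M₁ - 1) 0 0 (μ • M₂ - 1)) := by
    have h1 : R⁻¹ * sys.A = μ • (R⁻¹ * sys.E) - 1 := by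
      have : sys.A = μ • sys.E - R := by rw [hR]; abel
      rw [this, Matrix.mul_sub, Matrix.nonsing_inv_mul _ hRu, Matrix.mul_smul]
    rw [h1, Matrix.mul_sub, Matrix.sub_mul, Matrix.mul_one, Matrix.nonsing_inv_mul _ hPu,
      Matrix.mul_smul, Matrix.smul_mul, hM]
    ext i j
    obtain ⟨i, rfl⟩ := e.surjective i
    obtain ⟨j, rfl⟩ := e.surjective j
    rcases i with i | i <;> rcases j with j | j <;> simp [Matrix.one_apply]
  have hG : IsUnit (μ • M₂ - 1) := by
    refine IsNilpotent.isUnit_sub_one ?_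
    obtain ⟨k, hk⟩ := hM₂
    exact ⟨k, by rw [smul_pow, hk, smul_zero]⟩
  have hM₁d := (Matrix.isUnit_iff_isUnit_det M₁).1 hM₁
  have hGd := (Matrix.isUnit_iff_isUnit_det _).1 hG
  set G := μ • M₂ - 1 with hGdef
  -- Scaling by `M₁⁻¹` normalizes the slow block of `E`, and by `G⁻¹` the fast block of `A`.
  let T := Matrix.reindex e e (Matrix.fromBlocks M₁⁻¹ 0 0 G⁻¹)
  have hT : IsUnit T := by
    refine isUnit_iff_exists_inv.2 ⟨Matrix.reindex e e (Matrix.fromBlocks M₁ 0 0 G), ?_⟩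
    simp [T, Matrix.submatrix_mul_equiv, Matrix.fromBlocks_multiply,
      Matrix.nonsing_inv_mul _ hM₁d, Matrix.nonsing_inv_mul _ hGd]
  have hcomm : Commute G⁻¹ M₂ := by
    have h1 : Commute G M₂ := by
      rw [hGdef]
      exact ((Commute.refl M₂).smul_left μ).sub_left (Commute.one_left M₂)
    rw [Commute, SemiconjBy]
    calc G⁻¹ * M₂ = G⁻¹ * (M₂ * G) * G⁻¹ := by
          rw [Matrix.mul_assoc, Matrix.mul_assoc, Matrix.mul_nonsing_inv _ hGd, Matrix.mul_one]
      _ = M₂ * G⁻¹ := by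
          rw [← h1.eq, ← Matrix.mul_assoc, Matrix.nonsing_inv_mul _ hGd, Matrix.one_mul]
  refine ⟨⟨p, q, hpq, T * P⁻¹ * R⁻¹, P, M₁⁻¹ * (μ • M₁ - 1), G⁻¹ * M₂, ?_, hP,
    hcomm.isNilpotent_mul_left hM₂, ?_, ?_⟩⟩
  · exact (hT.mul ((Matrix.isUnit_nonsing_inv_iff).2 hP)).mul
      ((Matrix.isUnit_nonsing_inv_iff).2 ((Matrix.isUnit_iff_isUnit_det R).2 hRu))
  · have : T * P⁻¹ * R⁻¹ * sys.E * P = T * (P⁻¹ * (R⁻¹ * sys.E) * P) := by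
      simp only [Matrix.mul_assoc]
    rw [this, hM]
    change _ = Matrix.reindex e e _
    simp [T, Matrix.submatrix_mul_equiv, Matrix.fromBlocks_multiply,
      Matrix.nonsing_inv_mul _ hM₁d]
  · have : T * P⁻¹ * R⁻¹ * sys.A * P = T * (P⁻¹ * (R⁻¹ * sys.A) * P) := by
      simp only [Matrix.mul_assoc]
    rw [this, hA]
    change _ = Matrix.reindex e e _
    simp [T, Matrix.submatrix_mul_equiv, Matrix.fromBlocks_multiply,
      Matrix.nonsing_inv_mul _ hGd]

end DescriptorSystem

/-! ### Decoupled coordinates for trajectories and left null vectors. -/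

namespace DescriptorSystem

variable {nx nu ny : ℕ}

/-- R-controllability as triviality of the left kernel of `[z E - A, B]`. -/
theorem isRControllable_iff (sys : DescriptorSystem nx nu ny) :
    sys.IsRControllable ↔ ∀ (z : ℂ) (v : Fin nx → ℂ), v ᵥ* sys.pencil z = 0 →
      v ᵥ* sys.B.map Complex.ofReal = 0 → v = 0 := by
  refine forall_congr' fun z => ?_
  rw [rank_eq_iff_vecMul_eq_zero]
  refine forall_congr' fun v => ?_
  rw [Matrix.vecMul_fromCols, ← and_imp]
  refine imp_congr ⟨fun h => ⟨?_, ?_⟩, ?_⟩ Iff.rfl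
  · ext i; exact congrFun h (Sum.inl i)
  · ext i; exact congrFun h (Sum.inr i)
  · rintro ⟨h1, h2⟩
    rw [h1, h2]
    ext (i | i) <;> rfl

/-- The pencil acts on row vectors by `v ↦ z v E - v A`. -/
theorem vecMul_pencil (sys : DescriptorSystem nx nu ny) (z : ℂ) (v : Fin nx → ℂ) :
    v ᵥ* sys.pencil z =
      z • (v ᵥ* sys.E.map Complex.ofReal) - v ᵥ* sys.A.map Complex.ofReal := by
  rw [pencil, Matrix.vecMul_sub, Matrix.vecMul_smul]

namespace QuasiWeierstrassForm

variable {sys : DescriptorSystem nx nu ny} (Q : sys.QuasiWeierstrassForm)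

/-- The index equivalence of the block splitting. -/
def idx : Fin Q.nJ ⊕ Fin Q.nN ≃ Fin nx := finSumFinEquiv.trans (finCongr Q.dim_eq)

/-- `B_J`, the first `nJ` rows of `S B`. -/
def BJ : Matrix (Fin Q.nJ) (Fin nu) ℝ :=
  Matrix.of fun i j => (Q.S * sys.B) (Q.idx (Sum.inl i)) j

/-- The state with slow part `z` and fast part `w`. -/
def state (z : Fin Q.nJ → ℝ) (w : Fin Q.nN → ℝ) : Fin nx → ℝ :=
  Q.P *ᵥ (Sum.elim z w ∘ Q.idx.symm)

theorem exists_state_eq (x : Fin nx → ℝ) : ∃ z w, Q.state z w = x := by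
  refine ⟨(Q.P⁻¹ *ᵥ x) ∘ Q.idx ∘ Sum.inl, (Q.P⁻¹ *ᵥ x) ∘ Q.idx ∘ Sum.inr, ?_⟩
  have : Sum.elim ((Q.P⁻¹ *ᵥ x) ∘ Q.idx ∘ Sum.inl) ((Q.P⁻¹ *ᵥ x) ∘ Q.idx ∘ Sum.inr) ∘ Q.idx.symm
      = Q.P⁻¹ *ᵥ x := by
    ext i
    obtain ⟨i, rfl⟩ := Q.idx.surjective i
    rcases i with i | i <;> simp
  rw [state, this, Matrix.mulVec_mulVec,
    Matrix.mul_nonsing_inv _ ((Matrix.isUnit_iff_isUnit_det _).1 Q.isUnit_P), Matrix.one_mulVec]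

theorem transform_E_submatrix : Q.S * sys.E * Q.P =
    (Matrix.fromBlocks 1 0 0 Q.N).submatrix Q.idx.symm Q.idx.symm := Q.transform_E

theorem transform_A_submatrix : Q.S * sys.A * Q.P =
    (Matrix.fromBlocks Q.J 0 0 1).submatrix Q.idx.symm Q.idx.symm := Q.transform_A

theorem S_mulVec_E_mulVec_state (z : Fin Q.nJ → ℝ) (w : Fin Q.nN → ℝ) :
    Q.S *ᵥ (sys.E *ᵥ Q.state z w) = Sum.elim z (Q.N *ᵥ w) ∘ Q.idx.symm := by
  rw [state, Matrix.mulVec_mulVec, Matrix.mulVec_mulVec, transform_E_submatrix,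
    Matrix.submatrix_mulVec_equiv, Matrix.fromBlocks_mulVec]
  simp [Function.comp_assoc]

theorem S_mulVec_A_mulVec_state (z : Fin Q.nJ → ℝ) (w : Fin Q.nN → ℝ) :
    Q.S *ᵥ (sys.A *ᵥ Q.state z w) = Sum.elim (Q.J *ᵥ z) w ∘ Q.idx.symm := by
  rw [state, Matrix.mulVec_mulVec, Matrix.mulVec_mulVec, transform_A_submatrix,
    Matrix.submatrix_mulVec_equiv, Matrix.fromBlocks_mulVec]
  simp [Function.comp_assoc]

theorem S_mulVec_B_mulVec (u : Fin nu → ℝ) :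
    Q.S *ᵥ (sys.B *ᵥ u) = Sum.elim (Q.BJ *ᵥ u) (Q.BN *ᵥ u) ∘ Q.idx.symm := by
  rw [Matrix.mulVec_mulVec]
  ext i
  obtain ⟨i, rfl⟩ := Q.idx.surjective i
  rcases i with i | i <;> simp <;> rfl

theorem S_mulVec_injective : Function.Injective (Q.S *ᵥ ·) :=
  Matrix.mulVec_injective_iff_isUnit.2 Q.isUnit_S

/-- In quasi-Weierstrass coordinates the state equation decouples. -/
theorem state_equation_iff (z z' : Fin Q.nJ → ℝ) (w w' : Fin Q.nN → ℝ) (u : Fin nu → ℝ) :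
    sys.E *ᵥ Q.state z' w' = sys.A *ᵥ Q.state z w + sys.B *ᵥ u ↔
      z' = Q.J *ᵥ z + Q.BJ *ᵥ u ∧ Q.N *ᵥ w' = w + Q.BN *ᵥ u := by
  rw [← Q.S_mulVec_injective.eq_iff]
  simp only [Matrix.mulVec_add, S_mulVec_E_mulVec_state, S_mulVec_A_mulVec_state,
    S_mulVec_B_mulVec]
  have : ∀ (a c : Fin Q.nJ → ℝ) (b d : Fin Q.nN → ℝ),
      Sum.elim a b ∘ Q.idx.symm + Sum.elim c d ∘ Q.idx.symm
        = Sum.elim (a + c) (b + d) ∘ Q.idx.symm := by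
    intro a c b d
    ext i
    obtain ⟨i, rfl⟩ := Q.idx.surjective i
    rcases i with i | i <;> simp
  rw [this, Q.idx.symm.surjective.injective_comp_right.eq_iff, Sum.elim_eq_iff]

/-- The fast part of a trajectory is determined by the current and future inputs. -/
theorem fast_eq_neg_sum {w : ℕ → Fin Q.nN → ℝ} {u : ℕ → Fin nu → ℝ}
    (h : ∀ k, Q.N *ᵥ w (k + 1) = w k + Q.BN *ᵥ u k) (k : ℕ) :
    w k = -∑ i ∈ Finset.range Q.structuredIndex, (Q.N ^ i * Q.BN) *ᵥ u (k + i) := by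
  have key : ∀ m, w k = Q.N ^ m *ᵥ w (k + m)
      - ∑ i ∈ Finset.range m, (Q.N ^ i * Q.BN) *ᵥ u (k + i) := by
    intro m
    induction m with
    | zero => simp
    | succ m ih =>
      have h1 : Q.N ^ (m + 1) *ᵥ w (k + (m + 1))
          = Q.N ^ m *ᵥ w (k + m) + (Q.N ^ m * Q.BN) *ᵥ u (k + m) := by
        rw [pow_succ, ← Matrix.mulVec_mulVec, ← add_assoc, h, Matrix.mulVec_add,
          Matrix.mulVec_mulVec]
      rw [Finset.sum_range_succ, h1, add_sub_add_right_eq_sub]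
      exact ih
  -- The index `δ` kills `N ^ δ * BN` but perhaps not `N ^ δ`; unrolling further removes the
  -- remainder and adds only zero terms.
  obtain ⟨m, hm⟩ := Q.isNilpotent_N
  have h0 : Q.N ^ (Q.structuredIndex + m) = 0 := by rw [pow_add, hm, mul_zero]
  have hz : ∀ j, Q.N ^ (Q.structuredIndex + j) * Q.BN = 0 := by
    intro j
    rw [add_comm, pow_add, Matrix.mul_assoc, Q.structuredIndex_spec, Matrix.mul_zero]
  rw [key (Q.structuredIndex + m), h0, Matrix.zero_mulVec, zero_sub, Finset.sum_range_add]
  simp [hz]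

/-- Conversely, every input sequence admits a fast trajectory. -/
theorem fast_equation_neg_sum (u : ℕ → Fin nu → ℝ) (k : ℕ) :
    Q.N *ᵥ -∑ i ∈ Finset.range Q.structuredIndex, (Q.N ^ i * Q.BN) *ᵥ u (k + 1 + i)
      = -∑ i ∈ Finset.range Q.structuredIndex, (Q.N ^ i * Q.BN) *ᵥ u (k + i) + Q.BN *ᵥ u k := by
  -- The sum of `δ + 1` terms is split at either end; its last term vanishes by
  -- `structuredIndex_spec`.
  have h1 := Finset.sum_range_succ (fun i => (Q.N ^ i * Q.BN) *ᵥ u (k + i)) Q.structuredIndex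
  rw [Finset.sum_range_succ', Q.structuredIndex_spec, Matrix.zero_mulVec, add_zero (Finset.sum _ _)] at h1
  rw [← h1, Matrix.mulVec_neg, Matrix.mulVec_sum]
  simp only [pow_zero, Matrix.one_mul, add_zero, neg_add, neg_add_cancel_right]
  congr 1
  refine Finset.sum_congr rfl fun i _ => ?_
  rw [Matrix.mulVec_mulVec, ← Matrix.mul_assoc, ← pow_succ', add_assoc, add_comm 1 i]

/-- A complex row vector, expressed in the row coordinates of the form. -/
def covector (a : Fin Q.nJ → ℂ) (c : Fin Q.nN → ℂ) : Fin nx → ℂ :=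
  (Sum.elim a c ∘ Q.idx.symm) ᵥ* Q.S.map Complex.ofReal

theorem isUnit_map_S : IsUnit (Q.S.map Complex.ofReal) :=
  Q.isUnit_S.map Complex.ofRealHom.mapMatrix

theorem isUnit_map_P : IsUnit (Q.P.map Complex.ofReal) :=
  Q.isUnit_P.map Complex.ofRealHom.mapMatrix

theorem exists_covector_eq (v : Fin nx → ℂ) : ∃ a c, Q.covector a c = v := by
  obtain ⟨y, hy⟩ := Matrix.vecMul_surjective_iff_isUnit.2 Q.isUnit_map_S v
  refine ⟨y ∘ Q.idx ∘ Sum.inl, y ∘ Q.idx ∘ Sum.inr, ?_⟩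
  rw [← hy, covector]
  congr 1
  ext i
  obtain ⟨i, rfl⟩ := Q.idx.surjective i
  rcases i with i | i <;> simp

theorem covector_eq_zero_iff (a : Fin Q.nJ → ℂ) (c : Fin Q.nN → ℂ) :
    Q.covector a c = 0 ↔ a = 0 ∧ c = 0 := by
  have h0 : Q.covector 0 0 = 0 := by
    have : (Sum.elim 0 0 : Fin Q.nJ ⊕ Fin Q.nN → ℂ) = 0 := by ext (i | i) <;> rfl
    rw [covector, this]
    exact Matrix.zero_vecMul _
  rw [← h0, covector, covector,
    (Matrix.vecMul_injective_iff_isUnit.2 Q.isUnit_map_S).eq_iff,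
    Q.idx.symm.surjective.injective_comp_right.eq_iff, Sum.elim_eq_iff]

/-- Covectors without fast part suffice: `z N - 1` is invertible, so a left null vector of the
pencil has none. -/
theorem covector_vecMul_B (a : Fin Q.nJ → ℂ) :
    Q.covector a 0 ᵥ* sys.B.map Complex.ofReal = a ᵥ* Q.BJ.map Complex.ofReal := by
  have : Q.S.map Complex.ofReal * sys.B.map Complex.ofReal = (Q.S * sys.B).map Complex.ofReal :=
    (Matrix.map_mul (f := Complex.ofRealHom)).symm
  rw [covector, Matrix.vecMul_vecMul, this]
  ext j
  simp only [Matrix.vecMul, dotProduct]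
  rw [← Q.idx.sum_comp, Fintype.sum_sum_type]
  simp [BJ]

/-- In the coordinates of the form the pencil is `diag (z - J, z N - 1)`. -/
theorem covector_vecMul_pencil_mul_P (a : Fin Q.nJ → ℂ) (c : Fin Q.nN → ℂ) (z : ℂ) :
    (Q.covector a c ᵥ* sys.pencil z) ᵥ* Q.P.map Complex.ofReal =
      Sum.elim (z • a - a ᵥ* Q.J.map Complex.ofReal) (z • (c ᵥ* Q.N.map Complex.ofReal) - c)
        ∘ Q.idx.symm := by
  have h3 : ∀ X : Matrix (Fin nx) (Fin nx) ℝ,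
      (Q.covector a c ᵥ* X.map Complex.ofReal) ᵥ* Q.P.map Complex.ofReal
        = (Sum.elim a c ∘ Q.idx.symm) ᵥ* (Q.S * X * Q.P).map Complex.ofReal := by
    intro X
    have : (Q.S * X * Q.P).map Complex.ofReal
        = Q.S.map Complex.ofReal * X.map Complex.ofReal * Q.P.map Complex.ofReal := by
      change (Q.S * X * Q.P).map Complex.ofRealHom = _
      rw [Matrix.map_mul, Matrix.map_mul]
      rfl
    rw [this, covector, Matrix.vecMul_vecMul, Matrix.vecMul_vecMul, Matrix.mul_assoc]
  rw [vecMul_pencil, Matrix.sub_vecMul, Matrix.smul_vecMul, h3, h3,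
    transform_E_submatrix, transform_A_submatrix, ← Matrix.submatrix_map, ← Matrix.submatrix_map,
    Matrix.submatrix_vecMul_equiv,
    Matrix.submatrix_vecMul_equiv, Matrix.fromBlocks_map, Matrix.fromBlocks_map,
    Matrix.vecMul_fromBlocks, Matrix.vecMul_fromBlocks]
  ext i
  obtain ⟨i, rfl⟩ := Q.idx.surjective i
  rcases i with i | i <;> simp [Function.comp_assoc]

/-- R-controllability yields the Hautus criterion for the slow subsystem. -/
theorem hautus_of_isRControllable (h : sys.IsRControllable) (z : ℂ) (a : Fin Q.nJ → ℂ)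
    (ha : a ᵥ* Q.J.map Complex.ofReal = z • a) (hb : a ᵥ* Q.BJ.map Complex.ofReal = 0) :
    a = 0 := by
  refine ((Q.covector_eq_zero_iff a 0).1 (sys.isRControllable_iff.1 h z _ ?_ ?_)).1
  · apply Matrix.vecMul_injective_iff_isUnit.2 Q.isUnit_map_P
    change _ ᵥ* _ = _ ᵥ* _
    rw [covector_vecMul_pencil_mul_P, ha, Matrix.zero_vecMul]
    ext i
    obtain ⟨i, rfl⟩ := Q.idx.surjective i
    rcases i with i | i <;> simp
  · rw [covector_vecMul_B, hb]

end QuasiWeierstrassForm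

end DescriptorSystem

/-! ### Concatenation and sufficiency. -/

/-- Trajectories of `x (k + 1) = F (x k) (u k)` can be concatenated where the states agree. -/
theorem concat_step {X U : Type*} (F : X → U → X) {x x₂ : ℕ → X} {u u₂ : ℕ → U} (T : ℕ)
    (h : ∀ k, x (k + 1) = F (x k) (u k)) (h₂ : ∀ k, x₂ (k + 1) = F (x₂ k) (u₂ k))
    (hT : x T = x₂ 0) (k : ℕ) :
    (if k + 1 < T then x (k + 1) else x₂ (k + 1 - T)) =
      F (if k < T then x k else x₂ (k - T)) (if k < T then u k else u₂ (k - T)) := by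
  rcases lt_trichotomy (k + 1) T with hk | hk | hk
  · rw [if_pos hk, if_pos (by omega), if_pos (by omega), h]
  · rw [if_neg (by omega), if_pos (by omega), if_pos (by omega), ← h, hk, Nat.sub_self, hT]
  · rw [if_neg (by omega), if_neg (by omega), if_neg (by omega), ← h₂]
    congr 1
    omega

namespace DescriptorSystem

variable {nx nu ny : ℕ} {sys : DescriptorSystem nx nu ny}

/-- In quasi-Weierstrass coordinates every trajectory is given by a slow trajectory and its input. -/
theorem QuasiWeierstrassForm.exists_slow_of_mem_behavior (Q : sys.QuasiWeierstrassForm)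
    {b : ℕ → SignalSpace nx nu ny} (hb : b ∈ sys.behavior) :
    ∃ z : ℕ → Fin Q.nJ → ℝ, (∀ k, z (k + 1) = Q.J *ᵥ z k + Q.BJ *ᵥ (b k).2.1) ∧
      ∀ k, (b k).1 = Q.state (z k)
        (-∑ i ∈ Finset.range Q.structuredIndex, (Q.N ^ i * Q.BN) *ᵥ (b (k + i)).2.1) := by
  choose z w hzw using fun k => Q.exists_state_eq (b k).1
  have h : ∀ k, z (k + 1) = Q.J *ᵥ z k + Q.BJ *ᵥ (b k).2.1 ∧
      Q.N *ᵥ w (k + 1) = w k + Q.BN *ᵥ (b k).2.1 := fun k => by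
    rw [← Q.state_equation_iff, hzw, hzw]
    exact (hb k).1
  refine ⟨z, fun k => (h k).1, fun k => ?_⟩
  rw [← Q.fast_eq_neg_sum (u := fun k => (b k).2.1) fun k => (h k).2, hzw]

/-- R-controllability gives the uniform transition delay `δ - 1 + nJ`. -/
theorem IsRControllable.hasUniformTransitionDelay (h : sys.IsRControllable)
    (Q : sys.QuasiWeierstrassForm) :
    HasUniformTransitionDelay sys.behavior (Q.structuredIndex - 1 + Q.nJ) := by
  intro b hb b₂ hb₂ T
  obtain ⟨z, hz, hbz⟩ := Q.exists_slow_of_mem_behavior hb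
  obtain ⟨z₂, hz₂, hbz₂⟩ := Q.exists_slow_of_mem_behavior hb₂
  have hδ := Q.one_le_structuredIndex
  set δ := Q.structuredIndex with hδdef
  -- States before time `T` depend on inputs before `T + (δ - 1)`, so steering starts only there.
  obtain ⟨zs, us, hs0, hsn, hs⟩ := exists_steering Q.J Q.BJ (Q.hautus_of_isRControllable h)
    (z (T + (δ - 1))) (z₂ 0)
  let F : (Fin Q.nJ → ℝ) → (Fin nu → ℝ) → (Fin Q.nJ → ℝ) := fun x u => Q.J *ᵥ x + Q.BJ *ᵥ u
  have hstep := concat_step F Q.nJ hs hz₂ hsn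
  -- For `nJ = 0` the steering phase is empty and its two endpoints coincide.
  have hjoin : z (T + (δ - 1)) = if 0 < Q.nJ then zs 0 else z₂ (0 - Q.nJ) := by
    split_ifs with h0
    · exact hs0.symm
    · rw [← hs0, Nat.zero_sub, ← hsn]
      exact congrArg zs (by omega)
  have hstep' := concat_step F (x₂ := fun k => if k < Q.nJ then zs k else z₂ (k - Q.nJ))
    (u₂ := fun k => if k < Q.nJ then us k else (b₂ (k - Q.nJ)).2.1)
    (T + (δ - 1)) hz hstep hjoin
  set z' : ℕ → Fin Q.nJ → ℝ := fun k => if k < T + (δ - 1) then z k else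
    if k - (T + (δ - 1)) < Q.nJ then zs (k - (T + (δ - 1)))
    else z₂ (k - (T + (δ - 1)) - Q.nJ) with hz'
  set u' : ℕ → Fin nu → ℝ := fun k => if k < T + (δ - 1) then (b k).2.1 else
    if k - (T + (δ - 1)) < Q.nJ then us (k - (T + (δ - 1)))
    else (b₂ (k - (T + (δ - 1)) - Q.nJ)).2.1 with hu'
  let w' : ℕ → Fin Q.nN → ℝ := fun k =>
    -∑ i ∈ Finset.range δ, (Q.N ^ i * Q.BN) *ᵥ u' (k + i)
  let b' : ℕ → SignalSpace nx nu ny := fun k => (Q.state (z' k) (w' k), u' k,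
    sys.C *ᵥ Q.state (z' k) (w' k) + sys.D *ᵥ u' k)
  refine ⟨b', fun k => ⟨?_, rfl⟩, fun k hk => ?_, fun k hk => ?_⟩
  · exact (Q.state_equation_iff _ _ _ _ _).2 ⟨hstep' k, Q.fast_equation_neg_sum u' k⟩
  · have hu : u' k = (b k).2.1 := if_pos (by omega)
    have hx : Q.state (z' k) (w' k) = (b k).1 := by
      rw [hbz k]
      congr 1
      · exact if_pos (by omega)
      · refine congrArg Neg.neg (Finset.sum_congr rfl fun i hi => ?_)
        have := Finset.mem_range.1 hi
        have : u' (k + i) = (b (k + i)).2.1 := if_pos (by omega)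
        rw [this]
    refine Prod.ext hx (Prod.ext hu ?_)
    rw [(hb k).2, ← hx, ← hu]
  · have hu : ∀ j, T + (δ - 1 + Q.nJ) ≤ j → u' j = (b₂ (j - (T + (δ - 1 + Q.nJ)))).2.1 := by
      intro j hj
      simp only [hu']
      rw [if_neg (by omega), if_neg (by omega)]
      congr 3
      omega
    have hx : Q.state (z' k) (w' k) = (b₂ (k - (T + (δ - 1 + Q.nJ)))).1 := by
      rw [hbz₂]
      congr 1
      · simp only [hz']
        rw [if_neg (by omega), if_neg (by omega)]
        congr 1
        omega
      · refine congrArg Neg.neg (Finset.sum_congr rfl fun i hi => ?_)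
        rw [hu _ (by omega)]
        congr 4
        omega
    refine Prod.ext hx (Prod.ext (hu k hk) ?_)
    rw [(hb₂ _).2, ← hx, ← hu k hk]

/-! ### Necessity and conclusion. -/

/-- Controllability of the behavior implies R-controllability: a left eigenvector `v` of the pencil
annihilating `B` would yield the autonomous signal `v E x`, which cannot leave zero. -/
theorem isRControllable_of_isControllableBehavior (Q : sys.QuasiWeierstrassForm)
    (h : IsControllableBehavior sys.behavior) : sys.IsRControllable := by
  rw [isRControllable_iff]
  intro μ v hv hvB
  obtain ⟨a, c, rfl⟩ := Q.exists_covector_eq v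
  have hP := Q.covector_vecMul_pencil_mul_P a c μ
  rw [hv, Matrix.zero_vecMul] at hP
  -- The fast block gives `c = μ c N`; iteration and nilpotency of `N` finish.
  have hc : c = 0 := by
    have h1 : c = μ • (c ᵥ* Q.N.map Complex.ofReal) := by
      ext i
      have := congrFun hP (Q.idx (Sum.inr i))
      simpa [sub_eq_zero, eq_comm] using this
    have h2 : ∀ k : ℕ, c = μ ^ k • (c ᵥ* (Q.N.map Complex.ofReal) ^ k) := by
      intro k
      induction k with
      | zero => simp
      | succ k ih =>
        rw [pow_succ, pow_succ', ← Matrix.vecMul_vecMul, mul_smul, ← Matrix.smul_vecMul μ, ← h1]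
        exact ih
    obtain ⟨k, hk⟩ := Q.isNilpotent_N
    have h3 : (Q.N.map Complex.ofReal) ^ k = 0 := by
      have := congrArg Complex.ofRealHom.mapMatrix hk
      rwa [map_pow, map_zero] at this
    rw [h2 k, h3, Matrix.vecMul_zero, smul_zero]
  subst hc
  rw [Q.covector_eq_zero_iff]
  refine ⟨?_, rfl⟩
  set v := Q.covector a 0 with hvdef
  let ξ : (Fin nx → ℝ) → ℂ := fun x => v ⬝ᵥ (Complex.ofReal ∘ (sys.E *ᵥ x))
  have hmap : ∀ {m : ℕ} (X : Matrix (Fin nx) (Fin m) ℝ) (x : Fin m → ℝ),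
      v ⬝ᵥ (Complex.ofReal ∘ (X *ᵥ x))
        = (v ᵥ* X.map Complex.ofReal) ⬝ᵥ (Complex.ofReal ∘ x) := by
    intro m X x
    rw [← Matrix.dotProduct_mulVec]
    congr 1
    ext i
    exact RingHom.map_mulVec Complex.ofRealHom X x i
  have hξ : ∀ b ∈ sys.behavior, ∀ k, ξ (b (k + 1)).1 = μ * ξ (b k).1 := by
    intro b hb k
    have h1 : v ᵥ* sys.A.map Complex.ofReal = μ • (v ᵥ* sys.E.map Complex.ofReal) := by
      rw [vecMul_pencil, sub_eq_zero] at hv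
      exact hv.symm
    have h2 : (Complex.ofReal ∘ (sys.A *ᵥ (b k).1 + sys.B *ᵥ (b k).2.1) : Fin nx → ℂ)
        = Complex.ofReal ∘ (sys.A *ᵥ (b k).1) + Complex.ofReal ∘ (sys.B *ᵥ (b k).2.1) := by
      ext i
      simp
    simp only [ξ]
    rw [(hb k).1, h2, dotProduct_add, hmap, hmap, hmap, h1, hvB, zero_dotProduct, add_zero,
      smul_dotProduct, smul_eq_mul]
  have hξz : ∀ z : Fin Q.nJ → ℝ, ξ (Q.state z 0) = a ⬝ᵥ (Complex.ofReal ∘ z) := by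
    intro z
    have h1 : ∀ y : Fin nx → ℝ, v ⬝ᵥ (Complex.ofReal ∘ y)
        = (Sum.elim a 0 ∘ Q.idx.symm) ⬝ᵥ (Complex.ofReal ∘ (Q.S *ᵥ y)) := by
      intro y
      rw [hvdef, QuasiWeierstrassForm.covector, ← Matrix.dotProduct_mulVec]
      congr 1
      ext i
      exact (RingHom.map_mulVec Complex.ofRealHom Q.S y i).symm
    simp only [ξ]
    rw [h1, Q.S_mulVec_E_mulVec_state, dotProduct, ← Q.idx.sum_comp, Fintype.sum_sum_type]
    simp [dotProduct]
  have hzero : (0 : ℕ → SignalSpace nx nu ny) ∈ sys.behavior := by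
    intro k
    simp
  ext i
  -- The free motion from the `i`-th slow unit vector has initial value `ξ = a i`.
  let z : ℕ → Fin Q.nJ → ℝ := fun k => Q.J ^ k *ᵥ Pi.single i 1
  let b₂ : ℕ → SignalSpace nx nu ny := fun k => (Q.state (z k) 0, 0, sys.C *ᵥ Q.state (z k) 0)
  have hb₂ : b₂ ∈ sys.behavior := by
    intro k
    refine ⟨(Q.state_equation_iff _ _ _ _ _).2 ⟨?_, ?_⟩, ?_⟩
    · simp only [z, b₂, Matrix.mulVec_zero, add_zero, Matrix.mulVec_mulVec, pow_succ']
    · simp [b₂]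
    · simp [b₂]
  -- With `T = 1` the prescribed past contains time `0`, which makes `ξ` start at zero.
  obtain ⟨T', b', hb', hpast, hfut⟩ := h 0 hzero b₂ hb₂ 1
  have h0 : ∀ k, ξ (b' k).1 = 0 := by
    intro k
    induction k with
    | zero =>
      rw [hpast 0 one_pos]
      simp only [ξ, Pi.zero_apply, Prod.fst_zero, Matrix.mulVec_zero]
      simp [dotProduct]
    | succ k ih => rw [hξ b' hb', ih, mul_zero]
  have h1 := h0 (1 + T')
  rw [hfut _ le_rfl, Nat.sub_self] at h1
  have h2 := hξz (z 0)
  rw [show Q.state (z 0) 0 = (b₂ 0).1 from rfl, h1] at h2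
  have h3 : (Complex.ofReal ∘ z 0 : Fin Q.nJ → ℂ) = Pi.single i 1 := by
    ext j
    simp only [z, pow_zero, Matrix.one_mulVec, Function.comp_apply, Pi.single_apply]
    split_ifs <;> simp
  rw [h3, dotProduct_single_one] at h2
  exact h2.symm

end DescriptorSystem

/-- Nonemptiness keeps the claim about all forms from being vacuous. -/
theorem mainTheorem5 {nx nu ny : ℕ} (sys : DescriptorSystem nx nu ny) (hreg : sys.IsRegular) :
    (IsControllableBehavior sys.behavior ↔ sys.IsRControllable) ∧
    Nonempty sys.QuasiWeierstrassForm ∧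
    (sys.IsRControllable → ∀ Q : sys.QuasiWeierstrassForm,
      HasUniformTransitionDelay sys.behavior (Q.structuredIndex - 1 + Q.nJ)) := by
  obtain ⟨Q⟩ := hreg.nonempty_quasiWeierstrassForm
  exact ⟨⟨DescriptorSystem.isRControllable_of_isControllableBehavior Q,
    fun h b hb b₂ hb₂ T => ⟨_, h.hasUniformTransitionDelay Q b hb b₂ hb₂ T⟩⟩, ⟨Q⟩,
    fun h Q => h.hasUniformTransitionDelay Q⟩
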